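/- Let $\mathbb{K}$ be a field of characteristic zero. For $d,h\in\mathbb{K}[[x]]$ with $d(0)\neq 0$, $h(0)=0$ and $[x^1]h\neq 0$, let $(d,h)$ denote the infinite lower triangular matrix with entries $d_{i,j}=[x^i]\,d(x)h(x)^j$, $i,j\ge 0$. These matrices form a group $\mathcal{R}$ under matrix multiplication, the Riordan group. For $f,g\in\mathbb{K}[[x]]$ with $f(0)\neq0\neq g(0)$ write $T(f\mid g)=(f/g,\,x/g)$; every element of $\mathcal{R}$ is of this form for exactly one pair $f,g$. Let $\mathfrak{I}=\{D\in\mathcal{R} : D^2=I\}$ be the set of Riordan involutions, $\langle\mathfrak{I}\rangle$ the subgroup of $\mathcal{R}$ generated by it, $[\mathcal{R},\mathcal{R}]$ the commutator subgroup of $\mathcal{R}$, $\Omega_0=\{T(f\mid g)\in\mathcal{R} : [x^2]g=0\}$, which is a subgroup of $\mathcal{R}$, $[\mathcal{R},\mathcal{R}]_0=\Omega_0\cap[\mathcal{R},\mathcal{R}]$, and $\mathcal{K}=\{I,-I,\mathcal{I}_0^+,\mathcal{I}_0^-\}$ with $-I=(-1,x)$, $\mathcal{I}_0^+=(1,-x)$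 and $\mathcal{I}_0^-=(-1,-x)$; these are diagonal matrices. **Theorem.** $\mathcal{K}$ is a Klein four-group, and $$\langle\mathfrak{I}\rangle\;\cong\;[\mathcal{R},\mathcal{R}]_0\rtimes\mathcal{K},$$ where $\mathcal{K}$ acts on $[\mathcal{R},\mathcal{R}]_0$ by conjugation in $\mathcal{R}$. More precisely, $(D,K)\mapsto DK$ is an isomorphism of groups from $[\mathcal{R},\mathcal{R}]_0\rtimes\mathcal{K}$ onto $\langle\mathfrak{I}\rangle$. -/

import Mathlib

open PowerSeries

/-- `(d, h)` are admissible parameters of a Riordan matrix: `d` is invertible for the Cauchy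
product and `h` is invertible for composition. -/
def IsRiordanPair {K : Type*} [Field K] (d h : PowerSeries K) : Prop :=
  constantCoeff d ≠ 0 ∧ constantCoeff h = 0 ∧ coeff 1 h ≠ 0

/-- The infinite matrix with entries `[x^i] d(x) h(x)^j`, for `i, j ∈ ℕ`. -/
noncomputable def riordanMatrix {K : Type*} [Field K] (d h : PowerSeries K) : Matrix ℕ ℕ K :=
  Matrix.of fun i j => coeff i (d * h ^ j)

/-- The product of two infinite lower triangular matrices: row `i` of the first factor vanishes
beyond column `i`, so the usual sum over `k` is a sum over `k ≤ i`. -/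
def lowerMul {K : Type*} [Field K] (A B : Matrix ℕ ℕ K) : Matrix ℕ ℕ K :=
  Matrix.of fun i j => ∑ k ∈ Finset.range (i + 1), A i k * B k j

/-- The set of Riordan matrices over `K`. -/
@[ext]
structure Riordan (K : Type*) [Field K] where
  /-- The underlying infinite matrix. -/
  val : Matrix ℕ ℕ K
  exists_pair : ∃ d h : PowerSeries K, IsRiordanPair d h ∧ val = riordanMatrix d h

theorem coeff_pow_eq_zero_of_lt {K : Type*} [Field K] {h : PowerSeries K}
    (hh : constantCoeff h = 0) {i k : ℕ} (hik : i < k) (d : PowerSeries K) :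
    coeff i (d * h ^ k) = 0 := by
  obtain ⟨u, rfl⟩ := X_dvd_iff.2 hh
  rw [mul_pow, mul_left_comm, coeff_X_pow_mul', if_neg (by omega)]

theorem coeff_mul_subst_eq {K : Type*} [Field K] {h : PowerSeries K}
    (hh : constantCoeff h = 0) (d l : PowerSeries K) (i : ℕ) :
    coeff i (d * l.subst h) = ∑ k ∈ Finset.range (i + 1), coeff i (d * h ^ k) * coeff k l := by
  have hs : HasSubst h := HasSubst.of_constantCoeff_zero' hh
  have key : ∀ p ≤ i, coeff p (l.subst h)
      = ∑ k ∈ Finset.range (i + 1), coeff k l * coeff p (h ^ k) := by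
    intro p hp
    rw [coeff_subst' hs]
    rw [finsum_eq_sum_of_support_subset (s := Finset.range (i + 1))]
    · simp only [smul_eq_mul]
    · intro k hk
      simp only [Finset.coe_range, Set.mem_Iio]
      by_contra hcon
      apply hk
      have := coeff_pow_eq_zero_of_lt hh (i := p) (k := k) (by omega) 1
      rw [one_mul] at this
      simp [this]
  rw [coeff_mul]
  have : ∀ x ∈ Finset.HasAntidiagonal.antidiagonal i, coeff x.1 d * coeff x.2 (l.subst h)
      = ∑ k ∈ Finset.range (i + 1), coeff x.1 d * coeff x.2 (h ^ k) * coeff k l := by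
    intro x hx
    rw [key x.2 (by have := Finset.HasAntidiagonal.mem_antidiagonal.1 hx; omega), Finset.mul_sum]
    exact Finset.sum_congr rfl fun k _ => by ring
  rw [Finset.sum_congr rfl this, Finset.sum_comm]
  refine Finset.sum_congr rfl fun k _ => ?_
  rw [coeff_mul, Finset.sum_mul]

theorem constantCoeff_subst_eq {K : Type*} [Field K] {h : PowerSeries K}
    (hh : constantCoeff h = 0) (l : PowerSeries K) :
    constantCoeff (l.subst h : PowerSeries K) = constantCoeff l := by
  have := coeff_mul_subst_eq hh 1 l 0
  simpa using this

theorem coeff_one_subst_eq {K : Type*} [Field K] {h : PowerSeries K}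
    (hh : constantCoeff h = 0) (l : PowerSeries K) :
    coeff 1 (l.subst h : PowerSeries K) = coeff 1 h * coeff 1 l := by
  have := coeff_mul_subst_eq hh 1 l 1
  simpa [Finset.sum_range_succ, coeff_one] using this

theorem IsRiordanPair.mul {K : Type*} [Field K] {d h l m : PowerSeries K}
    (h1 : IsRiordanPair d h) (h2 : IsRiordanPair l m) :
    IsRiordanPair (d * l.subst h) (m.subst h) := by
  refine ⟨?_, ?_, ?_⟩
  · rw [map_mul, constantCoeff_subst_eq h1.2.1]
    exact mul_ne_zero h1.1 h2.1
  · rw [constantCoeff_subst_eq h1.2.1, h2.2.1]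
  · rw [coeff_one_subst_eq h1.2.1]
    exact mul_ne_zero h1.2.2 h2.2.2

theorem lowerMul_riordanMatrix {K : Type*} [Field K] {d h : PowerSeries K}
    (h1 : IsRiordanPair d h) (l m : PowerSeries K) :
    lowerMul (riordanMatrix d h) (riordanMatrix l m)
      = riordanMatrix (d * l.subst h) (m.subst h) := by
  have hs : HasSubst h := HasSubst.of_constantCoeff_zero' h1.2.1
  ext i j
  simp only [lowerMul, riordanMatrix, Matrix.of_apply]
  rw [← coeff_mul_subst_eq h1.2.1, subst_mul hs, subst_pow hs, mul_assoc]

theorem isRiordanPair_one (K : Type*) [Field K] : IsRiordanPair (1 : PowerSeries K) X := by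
  simp [IsRiordanPair]

theorem riordanMatrix_one (K : Type*) [Field K] :
    riordanMatrix (1 : PowerSeries K) X = (1 : Matrix ℕ ℕ K) := by
  ext i j
  simp [riordanMatrix, Matrix.one_apply, coeff_X_pow]

theorem riordanMatrix_injective {K : Type*} [Field K] {d h l m : PowerSeries K}
    (h1 : IsRiordanPair d h) (he : riordanMatrix d h = riordanMatrix l m) : d = l ∧ h = m := by
  have e0 : d = l := by
    ext i
    have := congrFun (congrFun he i) 0
    simpa [riordanMatrix] using this
  subst e0
  refine ⟨rfl, ?_⟩
  have e1 : d * h = d * m := by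
    ext i
    have := congrFun (congrFun he i) 1
    simpa [riordanMatrix] using this
  refine mul_left_cancel₀ (fun h0 => h1.1 ?_) e1
  rw [h0, map_zero]

theorem IsRiordanPair.exists_inv {K : Type*} [Field K] {d h : PowerSeries K}
    (h1 : IsRiordanPair d h) : ∃ e m : PowerSeries K, IsRiordanPair e m ∧
      e * d.subst m = 1 ∧ h.subst m = X := by
  have hu : IsUnit (coeff 1 h) := isUnit_iff_ne_zero.2 h1.2.2
  have hm0 : constantCoeff (substInvOfIsUnit h hu) = 0 := constantCoeff_substInvOfIsUnit h hu
  have hd : constantCoeff (d.subst (substInvOfIsUnit h hu) : PowerSeries K) ≠ 0 := by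
    rw [constantCoeff_subst_eq hm0]
    exact h1.1
  refine ⟨(d.subst (substInvOfIsUnit h hu) : PowerSeries K)⁻¹, substInvOfIsUnit h hu,
    ⟨?_, hm0, ?_⟩, PowerSeries.inv_mul_cancel _ hd, ?_⟩
  · rw [constantCoeff_inv]
    exact inv_ne_zero hd
  · rw [coeff_one_substInvOfIsUnit]
    exact Units.ne_zero _
  · exact subst_substInvOfIsUnit_right h h1.2.1 hu

namespace Riordan

/-- The Riordan matrix `(d, h)`. -/
noncomputable def mk' {K : Type*} [Field K] (d h : PowerSeries K) (hp : IsRiordanPair d h) :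
    Riordan K :=
  ⟨riordanMatrix d h, d, h, hp, rfl⟩

theorem exists_eq_mk' {K : Type*} [Field K] (D : Riordan K) :
    ∃ (d h : PowerSeries K) (hp : IsRiordanPair d h), D = mk' d h hp := by
  obtain ⟨d, h, hp, e⟩ := D.exists_pair
  exact ⟨d, h, hp, Riordan.ext e⟩

theorem mk'_inj {K : Type*} [Field K] {d h l m : PowerSeries K} (hp : IsRiordanPair d h)
    (hq : IsRiordanPair l m) : mk' d h hp = mk' l m hq ↔ d = l ∧ h = m := by
  constructor
  · intro e
    exact riordanMatrix_injective hp (congrArg Riordan.val e)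
  · rintro ⟨rfl, rfl⟩
    rfl

instance {K : Type*} [Field K] : Mul (Riordan K) where
  mul D E := ⟨lowerMul D.val E.val, by
    obtain ⟨d, h, hp, e⟩ := D.exists_pair
    obtain ⟨l, m, hq, e'⟩ := E.exists_pair
    exact ⟨_, _, hp.mul hq, by rw [e, e', lowerMul_riordanMatrix hp]⟩⟩

theorem val_mul {K : Type*} [Field K] (D E : Riordan K) :
    (D * E).val = lowerMul D.val E.val := rfl

theorem mk'_mul_mk' {K : Type*} [Field K] {d h l m : PowerSeries K} (hp : IsRiordanPair d h)
    (hq : IsRiordanPair l m) :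
    mk' d h hp * mk' l m hq = mk' (d * l.subst h) (m.subst h) (hp.mul hq) :=
  Riordan.ext (lowerMul_riordanMatrix hp l m)

noncomputable instance {K : Type*} [Field K] : One (Riordan K) where
  one := ⟨1, 1, X, isRiordanPair_one K, (riordanMatrix_one K).symm⟩

theorem val_one {K : Type*} [Field K] : (1 : Riordan K).val = 1 := rfl

theorem one_eq_mk' {K : Type*} [Field K] : (1 : Riordan K) = mk' 1 X (isRiordanPair_one K) :=
  Riordan.ext (riordanMatrix_one K).symm

theorem exists_left_inv {K : Type*} [Field K] (D : Riordan K) : ∃ E : Riordan K, E * D = 1 := by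
  obtain ⟨d, h, hp, rfl⟩ := D.exists_eq_mk'
  obtain ⟨e, m, hq, h1, h2⟩ := hp.exists_inv
  exact ⟨mk' e m hq, by rw [mk'_mul_mk', one_eq_mk', mk'_inj]; exact ⟨h1, h2⟩⟩

noncomputable instance {K : Type*} [Field K] : Inv (Riordan K) where
  inv D := D.exists_left_inv.choose

/-- The Riordan group: Riordan matrices under multiplication of infinite matrices. -/
noncomputable instance {K : Type*} [Field K] : Group (Riordan K) :=
  Group.ofLeftAxioms
    (by
      intro A B C
      obtain ⟨a, a', ha, rfl⟩ := A.exists_eq_mk'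
      obtain ⟨b, b', hb, rfl⟩ := B.exists_eq_mk'
      obtain ⟨c, c', hc, rfl⟩ := C.exists_eq_mk'
      have sa : HasSubst a' := HasSubst.of_constantCoeff_zero' ha.2.1
      have sb : HasSubst b' := HasSubst.of_constantCoeff_zero' hb.2.1
      simp only [mk'_mul_mk', mk'_inj]
      rw [subst_mul sa]
      exact ⟨by rw [mul_assoc, ← subst_comp_subst_apply sb sa],
        (subst_comp_subst_apply sb sa _).symm⟩)
    (by
      intro A
      obtain ⟨a, a', ha, rfl⟩ := A.exists_eq_mk'
      rw [one_eq_mk', mk'_mul_mk', mk'_inj]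
      simp)
    (fun D => D.exists_left_inv.choose_spec)

/-- The set of Riordan involutions: Riordan matrices whose square is the identity matrix. -/
def involutions (K : Type*) [Field K] : Set (Riordan K) := {D | D * D = 1}

/-- `D = T(f ∣ g)`: the entries of `D` are `[x^i] x^j f(x) / g(x)^(j+1)`, where `f` and `g` are
invertible for the Cauchy product. -/
def IsT {K : Type*} [Field K] (D : Riordan K) (f g : PowerSeries K) : Prop :=
  constantCoeff f ≠ 0 ∧ constantCoeff g ≠ 0 ∧
    ∀ i j : ℕ, D.val i j = coeff i (X ^ j * f * g⁻¹ ^ (j + 1))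

theorem isRiordanPair_T {K : Type*} [Field K] {f g : PowerSeries K}
    (hf : constantCoeff f ≠ 0) (hg : constantCoeff g ≠ 0) :
    IsRiordanPair (f * g⁻¹) (X * g⁻¹) := by
  refine ⟨?_, by simp, ?_⟩
  · rw [map_mul, constantCoeff_inv]
    exact mul_ne_zero hf (inv_ne_zero hg)
  · rw [show (1 : ℕ) = 0 + 1 from rfl, coeff_succ_X_mul, coeff_zero_eq_constantCoeff_apply,
      constantCoeff_inv]
    exact inv_ne_zero hg

theorem isT_iff {K : Type*} [Field K] {D : Riordan K} {f g : PowerSeries K}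
    (hf : constantCoeff f ≠ 0) (hg : constantCoeff g ≠ 0) :
    IsT D f g ↔ D = mk' (f * g⁻¹) (X * g⁻¹) (isRiordanPair_T hf hg) := by
  have key : ∀ i j : ℕ, (mk' (f * g⁻¹) (X * g⁻¹) (isRiordanPair_T hf hg)).val i j
      = coeff i (X ^ j * f * g⁻¹ ^ (j + 1)) := by
    intro i j
    simp only [mk', riordanMatrix, Matrix.of_apply]
    congr 1
    ring
  constructor
  · rintro ⟨-, -, h⟩
    apply Riordan.ext
    ext i j
    rw [h, key]
  · rintro rfl
    exact ⟨hf, hg, key⟩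

theorem isT_mk'_iff {K : Type*} [Field K] {d h f g : PowerSeries K} (hp : IsRiordanPair d h) :
    IsT (mk' d h hp) f g ↔ constantCoeff g ≠ 0 ∧ f = d * g ∧ h * g = X := by
  constructor
  · intro hT
    have hf := hT.1
    have hg := hT.2.1
    rw [isT_iff hf hg, mk'_inj] at hT
    obtain ⟨rfl, rfl⟩ := hT
    refine ⟨hg, ?_, ?_⟩
    · rw [mul_assoc, PowerSeries.inv_mul_cancel _ hg, mul_one]
    · rw [mul_assoc, PowerSeries.inv_mul_cancel _ hg, mul_one]
  · rintro ⟨hg, rfl, hX⟩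
    have hf : constantCoeff (d * g) ≠ 0 := by
      rw [map_mul]
      exact mul_ne_zero hp.1 hg
    rw [isT_iff hf hg, mk'_inj, ← hX]
    refine ⟨?_, ?_⟩
    · rw [mul_assoc, PowerSeries.mul_inv_cancel _ hg, mul_one]
    · rw [mul_assoc, PowerSeries.mul_inv_cancel _ hg, mul_one]

theorem exists_isT {K : Type*} [Field K] (D : Riordan K) : ∃ f g, IsT D f g := by
  obtain ⟨d, h, hp, rfl⟩ := D.exists_eq_mk'
  obtain ⟨u, rfl⟩ := X_dvd_iff.2 hp.2.1
  have hu : constantCoeff u ≠ 0 := by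
    have := hp.2.2
    rwa [show (1 : ℕ) = 0 + 1 from rfl, coeff_succ_X_mul,
      coeff_zero_eq_constantCoeff_apply] at this
  refine ⟨d * u⁻¹, u⁻¹, (isT_mk'_iff hp).2 ⟨?_, rfl, ?_⟩⟩
  · rw [constantCoeff_inv]
    exact inv_ne_zero hu
  · rw [mul_assoc, PowerSeries.mul_inv_cancel _ hu, mul_one]

theorem coeff_two_subst_X_mul {K : Type*} [Field K] (u s : PowerSeries K) :
    coeff 2 (s.subst (X * u) : PowerSeries K)
      = coeff 1 u * coeff 1 s + coeff 0 u ^ 2 * coeff 2 s := by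
  have := coeff_mul_subst_eq (h := X * u) (by simp) 1 s 2
  rw [one_mul] at this
  rw [this]
  have e1 : coeff 2 (X * u) = coeff 1 u := coeff_succ_X_mul 1 u
  have e2 : coeff 2 ((X * u) ^ 2) = coeff 0 u ^ 2 := by
    rw [mul_pow, coeff_X_pow_mul' , if_pos le_rfl]
    simp
  simp [Finset.sum_range_succ, e1, e2, coeff_one]

theorem coeff_one_subst_X_mul {K : Type*} [Field K] (u s : PowerSeries K) :
    coeff 1 (s.subst (X * u) : PowerSeries K) = coeff 0 u * coeff 1 s := by
  rw [coeff_one_subst_eq (by simp), show (1 : ℕ) = 0 + 1 from rfl, coeff_succ_X_mul]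

theorem coeff_zero_subst_X_mul {K : Type*} [Field K] (u s : PowerSeries K) :
    coeff 0 (s.subst (X * u) : PowerSeries K) = coeff 0 s := by
  rw [coeff_zero_eq_constantCoeff_apply, constantCoeff_subst_eq (by simp),
    coeff_zero_eq_constantCoeff_apply]

theorem coeff_mul_two {K : Type*} [Field K] (a b : PowerSeries K) :
    coeff 0 (a * b) = coeff 0 a * coeff 0 b ∧
    coeff 1 (a * b) = coeff 0 a * coeff 1 b + coeff 1 a * coeff 0 b ∧
    coeff 2 (a * b) = coeff 0 a * coeff 2 b + coeff 1 a * coeff 1 b + coeff 2 a * coeff 0 b := by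
  refine ⟨?_, ?_, ?_⟩ <;>
    simp [coeff_mul, Finset.Nat.antidiagonal_succ, add_assoc]

/-- The subgroup of all Riordan matrices `T(f ∣ g)` with `g₂ = 0`. -/
def omega0 (K : Type*) [Field K] : Subgroup (Riordan K) where
  carrier := {D | ∃ f g : PowerSeries K, IsT D f g ∧ coeff 2 g = 0}
  one_mem' := by
    refine ⟨1, 1, ?_, by simp [coeff_one]⟩
    rw [one_eq_mk', isT_mk'_iff]
    simp
  mul_mem' := by
    rintro D E ⟨f, g, hD, hg2⟩ ⟨r, s, hE, hs2⟩
    have hg := hD.2.1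
    have hs := hE.2.1
    have hf := hD.1
    have hr := hE.1
    have sh : HasSubst (X * g⁻¹ : PowerSeries K) :=
      HasSubst.of_constantCoeff_zero' (by simp)
    refine ⟨f * r.subst (X * g⁻¹), g * s.subst (X * g⁻¹), ?_, ?_⟩
    · rw [(isT_iff hf hg).1 hD, (isT_iff hr hs).1 hE, mk'_mul_mk', isT_mk'_iff]
      have e1 : (s⁻¹.subst (X * g⁻¹) : PowerSeries K) * s.subst (X * g⁻¹) = 1 := by
        rw [← subst_mul sh, PowerSeries.inv_mul_cancel _ hs, ← coe_substAlgHom sh, map_one]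
      have e2 : g⁻¹ * g = 1 := PowerSeries.inv_mul_cancel _ hg
      refine ⟨?_, ?_, ?_⟩
      · rw [map_mul, constantCoeff_subst_eq (by simp)]
        exact mul_ne_zero hg hs
      · rw [subst_mul sh]
        linear_combination
          (-(f * r.subst (X * g⁻¹) * (s⁻¹.subst (X * g⁻¹) : PowerSeries K)
            * s.subst (X * g⁻¹))) * e2 - (f * r.subst (X * g⁻¹)) * e1
      · rw [subst_mul sh, subst_X sh]
        linear_combination
          (X * (s⁻¹.subst (X * g⁻¹) : PowerSeries K) * s.subst (X * g⁻¹)) * e2 + X * e1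
    · have e := (coeff_mul_two g g⁻¹).2.1
      rw [PowerSeries.mul_inv_cancel _ hg, coeff_one, if_neg one_ne_zero] at e
      rw [(coeff_mul_two _ _).2.2, coeff_two_subst_X_mul, coeff_one_subst_X_mul,
        coeff_zero_subst_X_mul, hg2, hs2]
      linear_combination (-coeff 1 s) * e
  inv_mem' := by
    rintro D ⟨f, g, hD, hg2⟩
    obtain ⟨r, A, hE⟩ := exists_isT D⁻¹
    refine ⟨r, A, hE, ?_⟩
    have hg := hD.2.1
    have hA := hE.2.1
    have sm : HasSubst (X * A⁻¹ : PowerSeries K) :=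
      HasSubst.of_constantCoeff_zero' (by simp)
    have hmul := inv_mul_cancel D
    have q1 := (isT_iff hE.1 hA).1 hE
    have q2 := (isT_iff hD.1 hg).1 hD
    rw [q1] at hmul
    replace hmul := (congrArg (fun T => mk' (r * A⁻¹) (X * A⁻¹) (isRiordanPair_T hE.1 hA) * T)
      q2).symm.trans hmul
    rw [mk'_mul_mk', one_eq_mk', mk'_inj, subst_mul sm, subst_mul sm, subst_X sm] at hmul
    have e1 : (g⁻¹.subst (X * A⁻¹) : PowerSeries K) * g.subst (X * A⁻¹) = 1 := by
      rw [← subst_mul sm, PowerSeries.inv_mul_cancel _ hg, ← coe_substAlgHom sm, map_one]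
    have e2 : A⁻¹ * A = 1 := PowerSeries.inv_mul_cancel _ hA
    have e3 : A⁻¹ = g.subst (X * A⁻¹) := by
      have hX : (X : PowerSeries K) * A⁻¹ = X * g.subst (X * A⁻¹) := by
        linear_combination (g.subst (X * A⁻¹) : PowerSeries K) * hmul.2 - X * A⁻¹ * e1
      exact mul_left_cancel₀ X_ne_zero hX
    have w0 := congrArg (coeff 0) e3
    have w1 := congrArg (coeff 1) e3
    have w2 := congrArg (coeff 2) e3
    rw [coeff_zero_subst_X_mul] at w0
    rw [coeff_one_subst_X_mul] at w1
    rw [coeff_two_subst_X_mul, hg2] at w2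
    have p1 := (coeff_mul_two A⁻¹ A).2.1
    have p2 := (coeff_mul_two A⁻¹ A).2.2
    rw [e2, coeff_one, if_neg one_ne_zero] at p1
    rw [e2, coeff_one, if_neg two_ne_zero] at p2
    have h0 : coeff 0 A⁻¹ ≠ 0 := by
      rw [coeff_zero_eq_constantCoeff_apply, constantCoeff_inv]
      exact inv_ne_zero hA
    have : coeff 0 A⁻¹ * (coeff 0 A⁻¹ * coeff 2 A) = 0 := by
      linear_combination (-coeff 0 A⁻¹) * p2 + (coeff 1 A⁻¹) * p1
        - (coeff 0 A⁻¹ * coeff 0 A) * w2 + (coeff 1 A⁻¹ * coeff 0 A) * w1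
    exact (mul_eq_zero.1 ((mul_eq_zero.1 this).resolve_left h0)).resolve_left h0

/-- The subgroup `[R, R]₀ = Ω₀ ∩ [R, R]` of the Riordan group `R`. -/
noncomputable def commutator0 (K : Type*) [Field K] : Subgroup (Riordan K) :=
  omega0 K ⊓ commutator (Riordan K)

theorem isRiordanPair_diag {K : Type*} [Field K] (a b : Kˣ) :
    IsRiordanPair (C (a : K)) (C (b : K) * X) :=
  ⟨by simp, by simp, by simp⟩

/-- The diagonal Riordan matrix `(a, b x)`. -/
noncomputable def diag {K : Type*} [Field K] (a b : Kˣ) : Riordan K :=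
  mk' (C (a : K)) (C (b : K) * X) (isRiordanPair_diag a b)

theorem diag_val {K : Type*} [Field K] (a b : Kˣ) :
    (diag a b).val = Matrix.diagonal fun i => (a : K) * (b : K) ^ i := by
  ext i j
  simp only [diag, mk', riordanMatrix, Matrix.of_apply, mul_pow, ← map_pow]
  rw [coeff_C_mul, coeff_C_mul, coeff_X_pow, Matrix.diagonal_apply]
  split_ifs with h
  · rw [h, mul_one]
  · simp

theorem diag_mul_diag {K : Type*} [Field K] (a b a' b' : Kˣ) :
    diag a b * diag a' b' = diag (a * a') (b * b') := by
  apply Riordan.ext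
  rw [val_mul, diag_val, diag_val, diag_val]
  ext i j
  simp only [lowerMul, Matrix.of_apply, Matrix.diagonal_apply]
  rw [Finset.sum_eq_single i]
  · rw [if_pos rfl]
    split_ifs with h
    · push_cast
      ring
    · simp
  · intro k _ hk
    rw [if_neg (Ne.symm hk), zero_mul]
  · simp

theorem diag_one {K : Type*} [Field K] : diag (1 : Kˣ) 1 = 1 := by
  apply Riordan.ext
  rw [diag_val, val_one]
  simp

/-- The subgroup `{I, -I, I⁺₀, I⁻₀}` of diagonal matrices, where `-I = (-1, x)`,
`I⁺₀ = (1, -x) = diag(1, -1, 1, -1, …)` and `I⁻₀ = (-1, -x) = diag(-1, 1, -1, 1, …)`. -/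
noncomputable def klein (K : Type*) [Field K] : Subgroup (Riordan K) where
  carrier := {1, diag (-1) 1, diag 1 (-1), diag (-1) (-1)}
  one_mem' := by simp
  mul_mem' := by
    intro a b ha hb
    simp only [Set.mem_insert_iff, Set.mem_singleton_iff, ← diag_one] at ha hb ⊢
    rcases ha with rfl | rfl | rfl | rfl <;> rcases hb with rfl | rfl | rfl | rfl <;>
      simp [diag_mul_diag]
  inv_mem' := by
    intro a ha
    have h : a * a = 1 := by
      simp only [Set.mem_insert_iff, Set.mem_singleton_iff, ← diag_one] at ha ⊢
      rcases ha with rfl | rfl | rfl | rfl <;> simp [diag_mul_diag]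
    rwa [inv_eq_of_mul_eq_one_left h]

theorem diag_mem_omega0 {K : Type*} [Field K] (a b : Kˣ) : diag a b ∈ omega0 K := by
  refine ⟨C (a : K) * C ((b⁻¹ : Kˣ) : K), C ((b⁻¹ : Kˣ) : K), ?_, by simp⟩
  refine (isT_mk'_iff (isRiordanPair_diag a b)).2 ⟨by simp, rfl, ?_⟩
  rw [mul_right_comm, ← map_mul]
  simp

theorem klein_le_omega0 (K : Type*) [Field K] : klein K ≤ omega0 K := by
  intro a ha
  have ha' : a = 1 ∨ a = diag (-1) 1 ∨ a = diag 1 (-1) ∨ a = diag (-1) (-1) := ha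
  rcases ha' with rfl | rfl | rfl | rfl
  · exact one_mem _
  all_goals exact diag_mem_omega0 _ _

theorem klein_le_normalizer (K : Type*) [Field K] :
    klein K ≤ Subgroup.normalizer (commutator0 K : Set (Riordan K)) := by
  intro k hk
  have hk' := klein_le_omega0 K hk
  rw [Subgroup.mem_normalizer_iff]
  intro n
  have h1 : n ∈ omega0 K ↔ k * n * k⁻¹ ∈ omega0 K := by
    rw [Subgroup.mul_mem_cancel_right _ (inv_mem hk'), Subgroup.mul_mem_cancel_left _ hk']
  have h2 : n ∈ commutator (Riordan K) ↔ k * n * k⁻¹ ∈ commutator (Riordan K) := by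
    constructor
    · intro h
      exact Subgroup.Normal.conj_mem inferInstance n h k
    · intro h
      have := Subgroup.Normal.conj_mem inferInstance _ h k⁻¹
      simpa [mul_assoc] using this
  exact and_congr h1 h2

/-- The action of `klein K` on `commutator0 K` by conjugation, `k • n = k n k⁻¹`. -/
noncomputable def kleinAct (K : Type*) [Field K] : klein K →* MulAut (commutator0 K) :=
  (commutator0 K).normalizerMonoidHom.comp (Subgroup.inclusion (klein_le_normalizer K))

theorem coe_kleinAct_apply {K : Type*} [Field K] (k : klein K) (n : commutator0 K) :
    (kleinAct K k n : Riordan K) = k * n * (k : Riordan K)⁻¹ := rfl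

end Riordan

namespace Riordan

variable {K : Type*} [Field K]

/-! The map (n, k) ↦ nk is a homomorphism because the action is conjugation. It is injective because
diagonal entries are multiplicative, so commutators have unit diagonal, and the only such element of
the Klein group is I. What remains is that its image is the group generated by the involutions.

Every involution lies in the image. Averaging D with its diagonal part Δ gives P with DP = PΔ
(`exists_mul_eq_mul_diag`), so DΔ⁻¹ is the commutator of P and Δ. It lies in Ω₀ because comparing
coefficients in D² = I forces g₂ = 0 (`involution_mem_omega0`).

Conversely, the Klein group consists of elements with square I, so it remains to treat T(f ∣ g) with
f(0) = g(0) = 1 and g₂ = 0 (`mem_closure_of_isT`). Left multiplication by known products of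
involutions gives g₁ ≠ 0 and then (d, x/g) with d₁ = 0. Conjugation reduces (d, x/g) to (1, x/g),
and (1, x/g) to the Möbius element (1, x/(1 + g₁x)), which is a product of two involutions. The
conjugators come from linear functional equations solved coefficient by coefficient
(`exists_subst_solution`); each recursion has one resonant degree, where d₁ = 0, respectively g₂ =
0, is exactly the solvability condition. -/

/-! ### Linear functional equations solved by recursion on coefficients -/

theorem exists_triangular_solution (B : ℕ → ℕ → K) (c v : ℕ → K) (n₀ : ℕ)
    (hB : ∀ n, n₀ ≤ n → B n n ≠ 0) :
    ∃ u : ℕ → K, (∀ n < n₀, u n = v n) ∧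
      ∀ n, n₀ ≤ n → ∑ k ∈ Finset.range (n + 1), B n k * u k = c n := by
  -- Forward substitution: row n is solved for `u n`, and the rows below `n₀`, where the diagonal
  -- may vanish, are replaced by the prescribed values.
  let F : (n : ℕ) → ((m : ℕ) → m < n → K) → K := fun n r =>
    if n < n₀ then v n
    else (c n - ∑ k : Fin n, B n k * r k k.2) / B n n
  let u : ℕ → K := fun n => Nat.strongRec (motive := fun _ => K) F n
  have hu : ∀ n, u n = if n < n₀ then v n
      else (c n - ∑ k : Fin n, B n k * u k) / B n n := by
    intro n
    exact Nat.strongRec_eq (motive := fun _ => K) F n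
  refine ⟨u, fun n hn => by rw [hu, if_pos hn], fun n hn => ?_⟩
  rw [Finset.sum_range_succ, hu n, if_neg (by omega),
    Fin.sum_univ_eq_sum_range (fun k => B n k * u k) n, mul_div_cancel₀ _ (hB n hn)]
  ring

theorem coeff_one_pow_of_constantCoeff {p : PowerSeries K} (hp : constantCoeff p = 1) (n : ℕ) :
    coeff 1 (p ^ n) = n * coeff 1 p := by
  induction n with
  | zero => simp [coeff_one]
  | succ n ih =>
    rw [pow_succ, (coeff_mul_two _ _).2.1, ih]
    simp only [coeff_zero_eq_constantCoeff_apply, map_pow, hp]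
    push_cast
    ring

theorem coeff_one_mul_pow {d p : PowerSeries K} (hd : constantCoeff d = 1)
    (hp : constantCoeff p = 1) (n : ℕ) :
    coeff 1 (d * p ^ n) = n * coeff 1 p + coeff 1 d := by
  rw [(coeff_mul_two _ _).2.1, coeff_one_pow_of_constantCoeff hp]
  simp [coeff_zero_eq_constantCoeff_apply, hp, hd]

/-- Solutions of `d(x) u(x p(x)) = u(x) + c(x)` above a given degree, with prescribed
initial coefficients. -/
theorem exists_subst_solution {d p : PowerSeries K} (hd : constantCoeff d = 1)
    (hp : constantCoeff p = 1) (c v : PowerSeries K) (n₀ : ℕ)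
    (hB : ∀ n : ℕ, n₀ ≤ n → (n : K) * coeff 1 p + coeff 1 d ≠ 0) :
    ∃ u : PowerSeries K, (∀ n < n₀, coeff n u = coeff n v) ∧
      ∀ n, n₀ ≤ n → coeff (n + 1) (d * u.subst (X * p)) = coeff (n + 1) (u + c) := by
  have hdiag (n j : ℕ) : coeff (n + j) (d * (X * p) ^ n) = coeff j (d * p ^ n) := by
    rw [mul_pow, mul_left_comm, add_comm, coeff_X_pow_mul]
  obtain ⟨u, hu, hs⟩ := exists_triangular_solution
    (fun n k => coeff (n + 1) (d * (X * p) ^ k)) (fun n => coeff (n + 1) c)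
    (fun n => coeff n v) n₀ (by
      intro n hn
      rw [hdiag n 1, coeff_one_mul_pow hd hp]
      exact hB n hn)
  refine ⟨PowerSeries.mk u, fun n hn => by rw [coeff_mk, hu n hn], fun n hn => ?_⟩
  -- In degree n + 1 the top unknown uₙ₊₁ has coefficient 1 and cancels against the right-hand side.
  -- The equation therefore determines uₙ, with pivot n p₁ + d₁.
  rw [coeff_mul_subst_eq (by simp), Finset.sum_range_succ]
  simp only [coeff_mk, map_add]
  rw [hs n hn]
  have := hdiag (n + 1) 0
  rw [add_zero] at this
  rw [this]
  simp [hd, hp, add_comm]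

/-! ### Products, conjugates and substitution rules -/

theorem IsT.mul {D E : Riordan K} {f g r s : PowerSeries K} (hD : IsT D f g) (hE : IsT E r s) :
    IsT (D * E) (f * r.subst (X * g⁻¹)) (g * s.subst (X * g⁻¹)) := by
  have hg := hD.2.1
  have hs := hE.2.1
  have sh : HasSubst (X * g⁻¹ : PowerSeries K) :=
    HasSubst.of_constantCoeff_zero' (by simp)
  rw [(isT_iff hD.1 hg).1 hD, (isT_iff hE.1 hs).1 hE, mk'_mul_mk', isT_mk'_iff]
  have e1 : (s⁻¹.subst (X * g⁻¹) : PowerSeries K) * s.subst (X * g⁻¹) = 1 := by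
    rw [← subst_mul sh, PowerSeries.inv_mul_cancel _ hs, ← coe_substAlgHom sh, map_one]
  have e2 : g⁻¹ * g = 1 := PowerSeries.inv_mul_cancel _ hg
  refine ⟨?_, ?_, ?_⟩
  · rw [map_mul, constantCoeff_subst_eq (by simp)]
    exact mul_ne_zero hg hs
  · rw [subst_mul sh]
    linear_combination
      (-(f * r.subst (X * g⁻¹) * (s⁻¹.subst (X * g⁻¹) : PowerSeries K)
        * s.subst (X * g⁻¹))) * e2 - (f * r.subst (X * g⁻¹)) * e1
  · rw [subst_mul sh, subst_X sh]
    linear_combination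
      (X * (s⁻¹.subst (X * g⁻¹) : PowerSeries K) * s.subst (X * g⁻¹)) * e2 + X * e1

theorem mem_closure_of_mul_self {D : Riordan K} (h : D * D = 1) :
    D ∈ Subgroup.closure (involutions K) := Subgroup.subset_closure h

theorem conj_mem_closure_involutions {E : Riordan K} (hE : E ∈ Subgroup.closure (involutions K))
    (P : Riordan K) : P * E * P⁻¹ ∈ Subgroup.closure (involutions K) := by
  induction hE using Subgroup.closure_induction with
  | mem x hx =>
    apply mem_closure_of_mul_self
    have hx' : x * x = 1 := hx
    rw [show P * x * P⁻¹ * (P * x * P⁻¹) = P * (x * x) * P⁻¹ by group, hx']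
    group
  | one => simp
  | mul x y _ _ hx hy =>
    rw [show P * (x * y) * P⁻¹ = (P * x * P⁻¹) * (P * y * P⁻¹) by group]
    exact mul_mem hx hy
  | inv x _ hx =>
    rw [show P * x⁻¹ * P⁻¹ = (P * x * P⁻¹)⁻¹ by group]
    exact inv_mem hx

/-- Conjugacy is stated without inverses, so that using it only requires comparing two explicit
products of pairs. -/
theorem mem_closure_of_mul_eq {D E P : Riordan K} (h : D * P = P * E)
    (hE : E ∈ Subgroup.closure (involutions K)) : D ∈ Subgroup.closure (involutions K) := by
  rw [eq_mul_inv_of_mul_eq h]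
  exact conj_mem_closure_involutions hE P

theorem one_subst {a : PowerSeries K} (ha : constantCoeff a = 0) :
    (1 : PowerSeries K).subst a = (1 : PowerSeries K) := by
  rw [← coe_substAlgHom (HasSubst.of_constantCoeff_zero' ha), map_one]

theorem subst_inv_mul_subst {s a : PowerSeries K} (hs : constantCoeff s ≠ 0)
    (ha : constantCoeff a = 0) : (s⁻¹.subst a : PowerSeries K) * s.subst a = 1 := by
  rw [← subst_mul (HasSubst.of_constantCoeff_zero' ha), PowerSeries.inv_mul_cancel _ hs,
    one_subst ha]

theorem add_subst {a : PowerSeries K} (ha : constantCoeff a = 0) (s t : PowerSeries K) :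
    (s + t).subst a = (s.subst a + t.subst a : PowerSeries K) :=
  subst_add (HasSubst.of_constantCoeff_zero' ha) s t

theorem C_mul_subst {a : PowerSeries K} (ha : constantCoeff a = 0) (c : K) (s : PowerSeries K) :
    (C c * s).subst a = (C c * s.subst a : PowerSeries K) := by
  rw [← smul_eq_C_mul, subst_smul (HasSubst.of_constantCoeff_zero' ha), smul_eq_C_mul]

/-- `T(g ∣ g) = (1, x / g)`. -/
theorem isT_mk'_one {g : PowerSeries K} (hg : constantCoeff g ≠ 0)
    (hp : IsRiordanPair 1 (X * g⁻¹)) : IsT (mk' 1 (X * g⁻¹) hp) g g :=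
  (isT_mk'_iff hp).2 ⟨hg, (one_mul g).symm, by
    rw [mul_assoc, PowerSeries.inv_mul_cancel _ hg, mul_one]⟩

theorem isRiordanPair_X_mul_inv {d g : PowerSeries K} (hd : constantCoeff d ≠ 0)
    (hg : constantCoeff g ≠ 0) : IsRiordanPair d (X * g⁻¹) := by
  have := isRiordanPair_T hg hg
  exact ⟨hd, this.2⟩

/-! ### Products of involutions -/

/-- Both -x and m(x) = x/(bx - 1) are their own compositional inverses, and m(-x) = x/(1 + bx). -/
theorem mk'_moebius_mem (b : K) (hp : IsRiordanPair (1 : PowerSeries K) (X * (1 + C b * X)⁻¹)) :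
    mk' 1 (X * (1 + C b * X)⁻¹) hp ∈ Subgroup.closure (involutions K) := by
  have h1 : constantCoeff (1 + C b * X : PowerSeries K) ≠ 0 := by simp
  have h2 : constantCoeff (-1 + C b * X : PowerSeries K) ≠ 0 := by simp
  have hq : IsRiordanPair (1 : PowerSeries K) (-X) := by simp [IsRiordanPair]
  have hm : IsRiordanPair (1 : PowerSeries K) (X * (-1 + C b * X)⁻¹) :=
    isRiordanPair_X_mul_inv (by simp) h2
  have s1 : HasSubst (-X : PowerSeries K) := HasSubst.of_constantCoeff_zero' (by simp)
  have i1 : (mk' 1 (-X) hq) * (mk' 1 (-X) hq) = 1 := by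
    rw [mk'_mul_mk', one_eq_mk', mk'_inj, one_subst hq.2.1, ← coe_substAlgHom s1, map_neg,
      coe_substAlgHom, subst_X s1]
    simp
  have key (n : PowerSeries K) (hn : constantCoeff n = 0) :
      (-1 + C b * n) * ((X * (-1 + C b * X)⁻¹ : PowerSeries K).subst n) = n := by
    have e := subst_inv_mul_subst h2 hn
    have hs := HasSubst.of_constantCoeff_zero' hn
    have e' : ((-1 + C b * X : PowerSeries K).subst n : PowerSeries K) = -1 + C b * n := by
      rw [add_subst hn, C_mul_subst hn, subst_X hs, ← coe_substAlgHom hs, map_neg, map_one]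
    rw [subst_mul hs, subst_X hs]
    rw [e'] at e
    linear_combination n * e
  have i2 : (mk' 1 _ hm) * (mk' 1 _ hm) = 1 := by
    rw [mk'_mul_mk', one_eq_mk', mk'_inj, one_subst hm.2.1, mul_one]
    refine ⟨rfl, ?_⟩
    have e := key _ hm.2.1
    have e2 := PowerSeries.inv_mul_cancel _ h2
    have e3 : (-1 + C b * (X * (-1 + C b * X)⁻¹) : PowerSeries K) * (-1 + C b * X) = 1 := by
      linear_combination C b * X * e2
    linear_combination (-1 + C b * X) * e
      - (X * (-1 + C b * X)⁻¹ : PowerSeries K).subst (X * (-1 + C b * X)⁻¹ : PowerSeries K) * e3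
      + X * e2
  have hprod : mk' 1 (X * (1 + C b * X)⁻¹) hp = mk' 1 (-X) hq * mk' 1 _ hm := by
    rw [mk'_mul_mk', mk'_inj, one_subst hq.2.1, mul_one]
    refine ⟨rfl, ?_⟩
    have e := key _ hq.2.1
    have e2 := PowerSeries.inv_mul_cancel _ h1
    linear_combination (1 + C b * X)⁻¹ * e
      + (X * (-1 + C b * X)⁻¹ : PowerSeries K).subst (-X : PowerSeries K) * e2
  rw [hprod]
  exact mul_mem (mem_closure_of_mul_self i1) (mem_closure_of_mul_self i2)

theorem coeff_one_inv {g : PowerSeries K} (hg : constantCoeff g = 1) :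
    coeff 1 g⁻¹ = -coeff 1 g := by
  have e := (coeff_mul_two g g⁻¹).2.1
  rw [PowerSeries.mul_inv_cancel _ (by simp [hg]), coeff_one, if_neg one_ne_zero] at e
  simp only [coeff_zero_eq_constantCoeff_apply, constantCoeff_inv, hg] at e
  simp at e
  linear_combination -e

/-- With b = g₁, conjugating to (1, x/(1 + bx)) by (1, x/u) amounts to g·u(x/g) = u + bx. The pivots
of this recursion are b(1 - n). The one at n = 1 vanishes, and the degree 2 equation it governs
reduces to g₂ = 0. -/
theorem mk'_one_mem [CharZero K] {g : PowerSeries K} (hg0 : constantCoeff g = 1)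
    (hg1 : coeff 1 g ≠ 0) (hg2 : coeff 2 g = 0) (hp : IsRiordanPair 1 (X * g⁻¹)) :
    mk' 1 (X * g⁻¹) hp ∈ Subgroup.closure (involutions K) := by
  have hgi : constantCoeff g⁻¹ = 1 := by simp [hg0]
  have hg : constantCoeff g ≠ 0 := by simp [hg0]
  -- The choice u₀ = 1 is forced in degree 1, u₁ = 0 is a free choice, and the recursion takes over
  -- from n = 2. Degrees up to 2 are checked by hand below.
  obtain ⟨u, hu, hs⟩ := exists_subst_solution hg0 hgi (C (coeff 1 g) * X) 1 2 (by
    intro n hn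
    rw [coeff_one_inv hg0]
    have : (n : K) * -coeff 1 g + coeff 1 g = -(coeff 1 g * ((n : K) - 1)) := by ring
    rw [this, neg_ne_zero]
    refine mul_ne_zero hg1 (sub_ne_zero.2 ?_)
    exact_mod_cast (by omega : n ≠ 1))
  have u0 : coeff 0 u = 1 := by rw [hu 0 (by omega)]; simp
  have u1 : coeff 1 u = 0 := by rw [hu 1 (by omega)]; simp [coeff_one]
  have heq : g * u.subst (X * g⁻¹) = u + C (coeff 1 g) * X := by
    ext n
    obtain ⟨m0, m1, m2⟩ := coeff_mul_two g (u.subst (X * g⁻¹) : PowerSeries K)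
    rw [coeff_zero_subst_X_mul] at m0 m1 m2
    rw [coeff_one_subst_X_mul] at m1 m2
    rw [coeff_two_subst_X_mul] at m2
    have g0 : coeff 0 g = 1 := by rw [coeff_zero_eq_constantCoeff_apply, hg0]
    have c0 : coeff 0 g⁻¹ = 1 := by rw [coeff_zero_eq_constantCoeff_apply, hgi]
    rw [g0] at m0 m1 m2
    rw [u0] at m0 m1 m2
    rw [u1, c0] at m1 m2
    match n with
    | 0 => rw [m0]; simpa using u0.symm
    | 1 => rw [m1]; simp [u1]
    | 2 => rw [m2, hg2]; simp
    | n + 3 => exact hs (n + 2) (by omega)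
  have hu0 : constantCoeff u ≠ 0 := by
    rw [← coeff_zero_eq_constantCoeff_apply, u0]; exact one_ne_zero
  have hb : constantCoeff (1 + C (coeff 1 g) * X : PowerSeries K) ≠ 0 := by simp
  have hP : IsRiordanPair 1 (X * u⁻¹) := isRiordanPair_X_mul_inv (by simp) hu0
  have hM : IsRiordanPair 1 (X * (1 + C (coeff 1 g) * X : PowerSeries K)⁻¹) :=
    isRiordanPair_X_mul_inv (by simp) hb
  refine mem_closure_of_mul_eq (P := mk' 1 (X * u⁻¹) hP) ?_ (mk'_moebius_mem _ hM)
  rw [mk'_mul_mk', mk'_mul_mk', mk'_inj, one_subst hp.2.1, one_subst hP.2.1]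
  refine ⟨rfl, ?_⟩
  have sp := HasSubst.of_constantCoeff_zero' hp.2.1
  have sP := HasSubst.of_constantCoeff_zero' hP.2.1
  have e1 := subst_inv_mul_subst hu0 hp.2.1
  have e2 := subst_inv_mul_subst hb hP.2.1
  rw [add_subst hP.2.1, one_subst hP.2.1, C_mul_subst hP.2.1, subst_X sP] at e2
  rw [subst_mul sp, subst_mul sP, subst_X sp, subst_X sP]
  have e3 := PowerSeries.inv_mul_cancel _ hu0
  have e4 := PowerSeries.inv_mul_cancel _ hg
  set s : PowerSeries K := u.subst (X * g⁻¹)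
  set si : PowerSeries K := u⁻¹.subst (X * g⁻¹)
  set r : PowerSeries K := (1 + C (coeff 1 g) * X : PowerSeries K)⁻¹.subst (X * u⁻¹)
  set w : PowerSeries K := u + C (coeff 1 g) * X
  have hw : w ≠ 0 := by
    intro h
    have := congrArg constantCoeff h
    simp [w] at this
    exact hu0 this
  -- Both composites equal x/w: by the functional equation on one side, by clearing denominators on
  -- the other.
  have l : X * g⁻¹ * si * w = X := by
    linear_combination (-X * g⁻¹ * si) * heq + X * (si * s) * e4 + X * e1
  have r' : X * u⁻¹ * r * w = X := by
    simp only [w]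
    linear_combination X * e2 + X * r * e3
  exact mul_right_cancel₀ hw (l.trans r'.symm)

/-- Conjugation by (u, x) removes d as soon as d·u(x/g) = u. The pivots are -n g₁, so only n = 0 is
resonant, and the degree 1 equation it governs holds because d₁ = 0. -/
theorem mk'_mem_of_coeff_one_eq_zero [CharZero K] {d g : PowerSeries K}
    (hd0 : constantCoeff d = 1) (hd1 : coeff 1 d = 0) (hg0 : constantCoeff g = 1)
    (hg1 : coeff 1 g ≠ 0) (hg2 : coeff 2 g = 0) (hp : IsRiordanPair d (X * g⁻¹)) :
    mk' d (X * g⁻¹) hp ∈ Subgroup.closure (involutions K) := by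
  have hgi : constantCoeff g⁻¹ = 1 := by simp [hg0]
  have hg : constantCoeff g ≠ 0 := by simp [hg0]
  obtain ⟨u, hu, hs⟩ := exists_subst_solution hd0 hgi 0 1 1 (by
    intro n hn
    rw [coeff_one_inv hg0, hd1, add_zero]
    refine mul_ne_zero ?_ (neg_ne_zero.2 hg1)
    exact_mod_cast (by omega : n ≠ 0))
  have u0 : coeff 0 u = 1 := by rw [hu 0 (by omega)]; simp
  have heq : d * u.subst (X * g⁻¹) = u := by
    ext n
    obtain ⟨m0, m1, m2⟩ := coeff_mul_two d (u.subst (X * g⁻¹) : PowerSeries K)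
    rw [coeff_zero_subst_X_mul] at m0 m1
    rw [coeff_one_subst_X_mul] at m1
    have c0 : coeff 0 g⁻¹ = 1 := by rw [coeff_zero_eq_constantCoeff_apply, hgi]
    have d0 : coeff 0 d = 1 := by rw [coeff_zero_eq_constantCoeff_apply, hd0]
    match n with
    | 0 => rw [m0, d0, one_mul]
    | 1 => rw [m1, c0, d0, hd1]; ring
    | n + 2 => simpa using hs (n + 1) (by omega)
  have hu0 : constantCoeff u ≠ 0 := by
    rw [← coeff_zero_eq_constantCoeff_apply, u0]; exact one_ne_zero
  have hP : IsRiordanPair u X := ⟨hu0, by simp, by simp⟩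
  have hQ : IsRiordanPair 1 (X * g⁻¹) := isRiordanPair_X_mul_inv (by simp) hg
  refine mem_closure_of_mul_eq (P := mk' u X hP) ?_ (mk'_one_mem hg0 hg1 hg2 hQ)
  rw [mk'_mul_mk', mk'_mul_mk', mk'_inj, subst_X (HasSubst.of_constantCoeff_zero' hp.2.1), heq]
  simp

theorem mk'_neg_X_mul_self {q : PowerSeries K} (hq : q * q.subst (-X : PowerSeries K) = 1)
    (hp : IsRiordanPair q (-X)) : mk' q (-X) hp * mk' q (-X) hp = 1 := by
  have s1 : HasSubst (-X : PowerSeries K) := HasSubst.of_constantCoeff_zero' (by simp)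
  rw [mk'_mul_mk', one_eq_mk', mk'_inj, hq, ← coe_substAlgHom s1, map_neg,
    coe_substAlgHom, subst_X s1]
  simp

/-- If q(x)q(-x) = 1, then (q, -x) is an involution and (q, x) = (q, -x)(1, -x). The choice q = (1 +
cx/2)/(1 - cx/2) realizes any linear coefficient c. -/
theorem exists_mk'_X_mem [CharZero K] (c : K) : ∃ (q : PowerSeries K) (hq : IsRiordanPair q X),
    constantCoeff q = 1 ∧ coeff 1 q = c ∧ mk' q X hq ∈ Subgroup.closure (involutions K) := by
  have s1 : HasSubst (-X : PowerSeries K) := HasSubst.of_constantCoeff_zero' (by simp)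
  have n1 : constantCoeff (-X : PowerSeries K) = 0 := by simp
  set y : PowerSeries K := 1 - C (c / 2) * X
  set z : PowerSeries K := 1 + C (c / 2) * X
  have hy : constantCoeff y = 1 := by simp [y]
  have hz : constantCoeff z = 1 := by simp [z]
  have hq0 : constantCoeff (z * y⁻¹) = 1 := by simp [hy, hz]
  have sz : (z.subst (-X : PowerSeries K) : PowerSeries K) = y := by
    simp only [z, y]
    rw [add_subst n1, one_subst n1, C_mul_subst n1, subst_X s1]
    ring
  have sy : (y.subst (-X : PowerSeries K) : PowerSeries K) = z := by
    have : y = 1 + C (-(c / 2)) * X := by simp only [y, map_neg]; ring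
    rw [this, add_subst n1, one_subst n1, C_mul_subst n1, subst_X s1]
    simp only [z, map_neg]
    ring
  have hinv : z * y⁻¹ * (z * y⁻¹).subst (-X : PowerSeries K) = 1 := by
    have e := subst_inv_mul_subst (s := y) (by simp [hy]) n1
    have e2 := PowerSeries.inv_mul_cancel y (by simp [hy])
    rw [subst_mul s1, sz]
    rw [sy] at e
    linear_combination (z * (y⁻¹.subst (-X : PowerSeries K))) * e2 + e
  have hQ : IsRiordanPair (z * y⁻¹) (-X) := ⟨by simp [hq0], by simp, by simp⟩
  have hJ : IsRiordanPair (1 : PowerSeries K) (-X) := by simp [IsRiordanPair]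
  have hR : IsRiordanPair (z * y⁻¹) X := ⟨by simp [hq0], by simp, by simp⟩
  refine ⟨z * y⁻¹, hR, hq0, ?_, ?_⟩
  · rw [(coeff_mul_two _ _).2.1, coeff_one_inv hy]
    simp only [coeff_zero_eq_constantCoeff_apply, constantCoeff_inv, hy, hz]
    simp [y, z, coeff_one]
  · have : mk' (z * y⁻¹) X hR
        = mk' (z * y⁻¹) (-X) hQ * mk' 1 (-X) hJ := by
      rw [mk'_mul_mk', mk'_inj, one_subst n1, ← coe_substAlgHom s1, map_neg,
        coe_substAlgHom, subst_X s1]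
      simp
    rw [this]
    refine mul_mem (mem_closure_of_mul_self (mk'_neg_X_mul_self hinv hQ))
      (mem_closure_of_mul_self (mk'_neg_X_mul_self ?_ hJ))
    rw [one_subst n1, one_mul]

theorem mem_closure_of_isT_of_coeff_one_ne_zero [CharZero K] {D : Riordan K}
    {f g : PowerSeries K} (hT : IsT D f g) (hf0 : constantCoeff f = 1)
    (hg0 : constantCoeff g = 1) (hg1 : coeff 1 g ≠ 0) (hg2 : coeff 2 g = 0) :
    D ∈ Subgroup.closure (involutions K) := by
  rw [(isT_iff hT.1 hT.2.1).1 hT]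
  have hd0 : constantCoeff (f * g⁻¹) = 1 := by simp [hf0, hg0]
  -- Left multiplication by (q, x) replaces d by qd and leaves g alone; this q cancels the linear
  -- term of d.
  obtain ⟨q, hq, hq0, hq1, hmem⟩ := exists_mk'_X_mem (-coeff 1 (f * g⁻¹))
  refine (Subgroup.mul_mem_cancel_left _ hmem).1 ?_
  have h0 : constantCoeff (q * (f * g⁻¹)) = 1 := by rw [map_mul, hq0, hd0, one_mul]
  have hp : IsRiordanPair (q * (f * g⁻¹)) (X * g⁻¹) :=
    isRiordanPair_X_mul_inv (by simp [h0]) hT.2.1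
  have : mk' q X hq * mk' (f * g⁻¹) (X * g⁻¹) (isRiordanPair_T hT.1 hT.2.1)
      = mk' (q * (f * g⁻¹)) (X * g⁻¹) hp := by
    rw [mk'_mul_mk', mk'_inj]
    simp
  rw [this]
  refine mk'_mem_of_coeff_one_eq_zero h0 ?_ hg0 hg1 hg2 hp
  rw [(coeff_mul_two _ _).2.1]
  simp only [coeff_zero_eq_constantCoeff_apply, hq0, hq1, hd0]
  ring

theorem mem_closure_of_isT [CharZero K] {D : Riordan K} {f g : PowerSeries K} (hT : IsT D f g)
    (hf0 : constantCoeff f = 1) (hg0 : constantCoeff g = 1) (hg2 : coeff 2 g = 0) :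
    D ∈ Subgroup.closure (involutions K) := by
  by_cases hg1 : coeff 1 g = 0
  · have hb : constantCoeff (1 + C (1 : K) * X : PowerSeries K) ≠ 0 := by simp
    have hM : IsRiordanPair 1 (X * (1 + C (1 : K) * X : PowerSeries K)⁻¹) :=
      isRiordanPair_X_mul_inv (by simp) hb
    -- When g₁ = 0, left multiplication by (1, x/(1 + x)) turns g into (1 + x)·g(x/(1 + x)), whose
    -- linear coefficient is 1 and whose quadratic coefficient is still 0.
    refine (Subgroup.mul_mem_cancel_left _ (mk'_moebius_mem 1 hM)).1 ?_
    have hE := (isT_mk'_one hb hM).mul hT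
    have g0 : coeff 0 g = 1 := by rw [coeff_zero_eq_constantCoeff_apply, hg0]
    refine mem_closure_of_isT_of_coeff_one_ne_zero hE ?_ ?_ ?_ ?_
    · rw [map_mul, constantCoeff_subst_eq hM.2.1]; simp [hf0]
    · rw [map_mul, constantCoeff_subst_eq hM.2.1]; simp [hg0]
    · rw [(coeff_mul_two _ _).2.1, coeff_one_subst_X_mul, coeff_zero_subst_X_mul, hg1, g0]
      simp [coeff_one]
    · rw [(coeff_mul_two _ _).2.2, coeff_one_subst_X_mul, coeff_zero_subst_X_mul,
        coeff_two_subst_X_mul, hg1, hg2]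
      simp [coeff_one, coeff_X]
  · exact mem_closure_of_isT_of_coeff_one_ne_zero hT hf0 hg0 hg1 hg2

/-! ### Diagonal entries of commutators -/

theorem val_apply_of_lt (D : Riordan K) {i j : ℕ} (hij : i < j) : D.val i j = 0 := by
  obtain ⟨d, h, hp, rfl⟩ := D.exists_eq_mk'
  exact coeff_pow_eq_zero_of_lt hp.2.1 hij d

/-- A fixed diagonal entry is multiplicative. -/
noncomputable def diagEntry (i : ℕ) : Riordan K →* K where
  toFun D := D.val i i
  map_one' := by rw [val_one]; simp
  map_mul' D E := by
    simp only [val_mul, lowerMul, Matrix.of_apply]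
    rw [Finset.sum_eq_single i]
    · intro k hk hki
      rw [E.val_apply_of_lt (by have := Finset.mem_range.1 hk; omega), mul_zero]
    · simp

theorem diagEntry_of_mem_commutator {D : Riordan K} (hD : D ∈ commutator (Riordan K)) (i : ℕ) :
    D.val i i = 1 := by
  have h := Abelianization.commutator_subset_ker (diagEntry (K := K) i).toHomUnits hD
  exact congrArg Units.val (MonoidHom.mem_ker.1 h)

/-- Of membership in the commutator subgroup, only two diagonal entries matter: f₀/g₀ = 1 and f₀/g₀²
= 1 give f₀ = g₀ = 1. -/
theorem commutator0_le_closure [CharZero K] :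
    commutator0 K ≤ Subgroup.closure (involutions K) := by
  rintro D ⟨⟨f, g, hT, hg2⟩, hD⟩
  have h0 := diagEntry_of_mem_commutator hD 0
  have h1 := diagEntry_of_mem_commutator hD 1
  rw [hT.2.2] at h0 h1
  have hg := hT.2.1
  have h0' : constantCoeff f * (constantCoeff g)⁻¹ = 1 := by simpa using h0
  have h1' : constantCoeff f * ((constantCoeff g)⁻¹) ^ 2 = 1 := by
    rw [pow_one, mul_assoc, show (1 : ℕ) = 0 + 1 from rfl, coeff_succ_X_mul] at h1
    simpa using h1
  have hg0 : constantCoeff g = 1 := by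
    have : (constantCoeff g)⁻¹ = 1 := by
      linear_combination h1' - (constantCoeff g)⁻¹ * h0'
    exact inv_eq_one.1 this
  have hf0 : constantCoeff f = 1 := by simpa [hg0] using h0'
  exact mem_closure_of_isT hT hf0 hg0 hg2

/-! ### The Klein group and the decomposition of involutions -/

theorem diag_inj {a b a' b' : Kˣ} : diag a b = diag a' b' ↔ a = a' ∧ b = b' := by
  constructor
  · intro h
    obtain ⟨h1, h2⟩ := (mk'_inj _ _).1 h
    have e1 := congrArg constantCoeff h1
    have e2 := congrArg (coeff 1) h2
    simp at e1 e2
    exact ⟨Units.ext e1, Units.ext e2⟩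
  · rintro ⟨rfl, rfl⟩
    rfl

theorem mem_klein_iff {D : Riordan K} :
    D ∈ klein K ↔ ∃ a b : Kˣ, a * a = 1 ∧ b * b = 1 ∧ D = diag a b := by
  have hc : D ∈ klein K ↔ D = 1 ∨ D = diag (-1) 1 ∨ D = diag 1 (-1) ∨ D = diag (-1) (-1) :=
    Iff.rfl
  rw [hc]
  constructor
  · rintro (rfl | rfl | rfl | rfl)
    · exact ⟨1, 1, by simp, by simp, diag_one.symm⟩
    · exact ⟨-1, 1, by simp, by simp, rfl⟩
    · exact ⟨1, -1, by simp, by simp, rfl⟩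
    · exact ⟨-1, -1, by simp, by simp, rfl⟩
  · rintro ⟨a, b, ha, hb, rfl⟩
    have key (x : Kˣ) (hx : x * x = 1) : x = 1 ∨ x = -1 := by
      have : (x : K) * x = 1 := by rw [← Units.val_mul, hx, Units.val_one]
      rcases mul_self_eq_one_iff.1 this with h | h
      · exact Or.inl (Units.ext (by simpa using h))
      · exact Or.inr (Units.ext (by simpa using h))
    rcases key a ha with rfl | rfl <;> rcases key b hb with rfl | rfl <;> simp [diag_one]

theorem mul_self_of_mem_klein {D : Riordan K} (hD : D ∈ klein K) : D * D = 1 := by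
  obtain ⟨a, b, ha, hb, rfl⟩ := mem_klein_iff.1 hD
  rw [diag_mul_diag, ha, hb, diag_one]

theorem klein_inf_commutator0 {D : Riordan K} (hK : D ∈ klein K) (hC : D ∈ commutator0 K) :
    D = 1 := by
  obtain ⟨a, b, -, -, rfl⟩ := mem_klein_iff.1 hK
  have h0 := diagEntry_of_mem_commutator hC.2 0
  have h1 := diagEntry_of_mem_commutator hC.2 1
  rw [diag_val] at h0 h1
  simp at h0 h1
  subst h0
  simp at h1
  rw [h1, diag_one]

theorem involution_mem_omega0 [CharZero K] {D : Riordan K} (hD : D * D = 1) : D ∈ omega0 K := by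
  obtain ⟨f, g, hT⟩ := exists_isT D
  refine ⟨f, g, hT, ?_⟩
  have hg := hT.2.1
  have hmul : IsT (1 : Riordan K) _ _ := hD ▸ hT.mul hT
  rw [one_eq_mk', isT_mk'_iff] at hmul
  -- The second parameter of D² is g·g(x/g), while that of I is 1.
  have e : g * g.subst (X * g⁻¹) = 1 := mul_left_cancel₀ X_ne_zero (hmul.2.2.trans (mul_one X).symm)
  obtain ⟨m0, m1, m2⟩ := coeff_mul_two g (g.subst (X * g⁻¹) : PowerSeries K)
  rw [e, coeff_zero_subst_X_mul] at m0 m1 m2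
  rw [coeff_one_subst_X_mul] at m1 m2
  rw [coeff_two_subst_X_mul] at m2
  obtain ⟨p0, p1, -⟩ := coeff_mul_two g g⁻¹
  rw [PowerSeries.mul_inv_cancel _ hg] at p0 p1
  simp only [coeff_one, if_pos, if_neg one_ne_zero, if_neg two_ne_zero] at m0 m1 m2 p0 p1
  have hsq : coeff 0 g * coeff 0 g = 1 := m0.symm
  have q0 : coeff 0 g⁻¹ = coeff 0 g := by
    linear_combination (coeff 0 g⁻¹) * m0 - coeff 0 g * p0
  rw [q0] at m1 m2 p1
  have h2 : (2 : K) ≠ 0 := two_ne_zero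
  -- For g₀ = 1, degree 1 gives g₁ = 0 and then degree 2 gives 2g₂ = 0. For g₀ = -1, g₁ stays free,
  -- but its squares cancel in degree 2 and again leave 2g₂ = 0.
  rcases mul_self_eq_one_iff.1 hsq with h | h
  · rw [h] at m1 m2 p1
    have g1 : coeff 1 g = 0 := (mul_eq_zero.1 (by linear_combination -m1 :
      (2 : K) * coeff 1 g = 0)).resolve_left h2
    rw [g1] at m2
    exact (mul_eq_zero.1 (by linear_combination -m2 :
      (2 : K) * coeff 2 g = 0)).resolve_left h2
  · rw [h] at m1 m2 p1
    have q1 : coeff 1 g⁻¹ = -coeff 1 g := by linear_combination p1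
    rw [q1] at m2
    exact (mul_eq_zero.1 (by linear_combination m2 :
      (2 : K) * coeff 2 g = 0)).resolve_left h2

/-- A Riordan involution is conjugate to its diagonal part. -/
theorem exists_mul_eq_mul_diag [CharZero K] {D : Riordan K} (hD : D * D = 1) :
    ∃ (P : Riordan K) (a b : Kˣ), a * a = 1 ∧ b * b = 1 ∧ D * P = P * diag a b := by
  obtain ⟨d, h, hp, rfl⟩ := D.exists_eq_mk'
  rw [mk'_mul_mk', one_eq_mk', mk'_inj] at hD
  obtain ⟨hd, hh⟩ := hD
  have sh := HasSubst.of_constantCoeff_zero' hp.2.1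
  have ha : constantCoeff d * constantCoeff d = 1 := by
    have := congrArg constantCoeff hd
    rwa [map_mul, constantCoeff_subst_eq hp.2.1, map_one] at this
  have hb : coeff 1 h * coeff 1 h = 1 := by
    have := congrArg (coeff 1) hh
    rwa [coeff_one_subst_eq hp.2.1, coeff_one_X] at this
  have h2 : (1 : K) + 1 ≠ 0 := by rw [one_add_one_eq_two]; exact two_ne_zero
  let a : Kˣ := ⟨_, _, ha, ha⟩
  let b : Kˣ := ⟨_, _, hb, hb⟩
  -- Averaging over the group of order two: since h(h(x)) = x and b² = 1, φ = x + bh satisfies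
  -- φ(h(x)) = bφ(x), and likewise u = 1 + ad satisfies d·u(h) = au. The leading coefficients are 1
  -- + a² = 1 + b² = 2, nonzero in characteristic zero.
  have hP : IsRiordanPair (1 + C (a : K) * d) (X + C (b : K) * h) := by
    refine ⟨?_, ?_, ?_⟩
    · simp [a, ha, h2]
    · simp [hp.2.1]
    · simp [b, hb, h2]
  refine ⟨mk' _ _ hP, a, b, Units.ext ha, Units.ext hb, ?_⟩
  have sP := HasSubst.of_constantCoeff_zero' hP.2.1
  have ca : (C (a : K) * C (a : K) : PowerSeries K) = 1 := by
    rw [← map_mul]; exact (congrArg C ha).trans (map_one _)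
  have cb : (C (b : K) * C (b : K) : PowerSeries K) = 1 := by
    rw [← map_mul]; exact (congrArg C hb).trans (map_one _)
  rw [diag, mk'_mul_mk', mk'_mul_mk', mk'_inj]
  constructor
  · rw [add_subst hp.2.1, one_subst hp.2.1, C_mul_subst hp.2.1,
      ← mul_one (C (a : K) : PowerSeries K), C_mul_subst hP.2.1, one_subst hP.2.1]
    linear_combination C (a : K) * hd - d * ca
  · rw [add_subst hp.2.1, C_mul_subst hp.2.1, C_mul_subst hP.2.1, subst_X sh, subst_X sP, hh]
    linear_combination - h * cb

theorem involution_eq_mul [CharZero K] {D : Riordan K} (hD : D * D = 1) :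
    ∃ n ∈ commutator0 K, ∃ k ∈ klein K, n * k = D := by
  obtain ⟨P, a, b, ha, hb, h⟩ := exists_mul_eq_mul_diag hD
  have hk : diag a b ∈ klein K := mem_klein_iff.2 ⟨a, b, ha, hb, rfl⟩
  refine ⟨D * (diag a b)⁻¹, ⟨?_, ?_⟩, diag a b, hk, by group⟩
  · exact (omega0 K).mul_mem (involution_mem_omega0 hD) ((omega0 K).inv_mem (diag_mem_omega0 a b))
  · rw [eq_mul_inv_of_mul_eq h]
    exact Subgroup.commutator_mem_commutator (Subgroup.mem_top P) (Subgroup.mem_top (diag a b))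

theorem isKleinFour_klein [CharZero K] : IsKleinFour (klein K) := by
  have hne : (-1 : Kˣ) ≠ 1 := fun h => by
    have := congrArg Units.val h
    norm_num at this
  have hcard : Nat.card (klein K) = 4 := by
    change Set.ncard ({1, diag (-1) 1, diag 1 (-1), diag (-1) (-1)} : Set (Riordan K)) = 4
    rw [Set.ncard_insert_of_notMem, Set.ncard_insert_of_notMem, Set.ncard_pair] <;>
      simp [← diag_one, diag_inj, hne, hne.symm]
  refine ⟨hcard, ?_⟩
  have hdvd : Monoid.exponent (klein K) ∣ 2 := by
    refine Monoid.exponent_dvd_of_forall_pow_eq_one fun k => ?_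
    rw [pow_two]
    exact Subtype.ext (mul_self_of_mem_klein k.2)
  refine ((Nat.dvd_prime Nat.prime_two).1 hdvd).resolve_left fun h => ?_
  have := Monoid.exp_eq_one_iff.1 h
  rw [Nat.card_of_subsingleton (1 : klein K)] at hcard
  omega

/-! ### The semidirect product -/

/-- The homomorphism `(n, k) ↦ n k` from the semidirect product to the Riordan group. -/
noncomputable def mulHom (K : Type*) [Field K] :
    (commutator0 K ⋊[kleinAct K] klein K) →* Riordan K :=
  SemidirectProduct.lift (commutator0 K).subtype (klein K).subtype fun k => by
    ext n
    simp [coe_kleinAct_apply]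

theorem mulHom_apply (x : commutator0 K ⋊[kleinAct K] klein K) :
    mulHom K x = (x.left : Riordan K) * (x.right : Riordan K) := rfl

theorem mulHom_injective : Function.Injective (mulHom K) := by
  rw [injective_iff_map_eq_one]
  rintro ⟨n, k⟩ h
  rw [mulHom_apply] at h
  have hn : (n : Riordan K) = (k : Riordan K)⁻¹ := eq_inv_of_mul_eq_one_left h
  have hn1 : (n : Riordan K) = 1 := klein_inf_commutator0 (hn ▸ inv_mem k.2) n.2
  have hk1 : (k : Riordan K) = 1 := by rwa [hn1, one_mul] at h
  exact SemidirectProduct.ext (Subtype.ext hn1) (Subtype.ext hk1)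

theorem range_mulHom [CharZero K] :
    (mulHom K).range = Subgroup.closure (involutions K) := by
  apply le_antisymm
  · rintro _ ⟨⟨n, k⟩, rfl⟩
    exact mul_mem (commutator0_le_closure n.2)
      (mem_closure_of_mul_self (mul_self_of_mem_klein k.2))
  · rw [Subgroup.closure_le]
    intro D hD
    obtain ⟨n, hn, k, hk, rfl⟩ := involution_eq_mul hD
    exact ⟨⟨⟨n, hn⟩, ⟨k, hk⟩⟩, rfl⟩

end Riordan

theorem theoremC {K : Type*} [Field K] [CharZero K] :
    IsKleinFour (Riordan.klein K) ∧
      ∃ e : (Riordan.commutator0 K ⋊[Riordan.kleinAct K] Riordan.klein K) ≃*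
          Subgroup.closure (Riordan.involutions K),
        ∀ (n : Riordan.commutator0 K) (k : Riordan.klein K),
          (e ⟨n, k⟩ : Riordan K) = (n : Riordan K) * (k : Riordan K) :=
  ⟨Riordan.isKleinFour_klein,
    (MonoidHom.ofInjective Riordan.mulHom_injective).trans
      (MulEquiv.subgroupCongr Riordan.range_mulHom), fun _ _ => rfl⟩
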